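/- Let $G$ be a finite connected simple graph with $n\ge 2$ vertices, embedded in the plane (equivalently, on the sphere); the embedding is described combinatorially, by a rotation system of $G$ of genus $0$. Let $F_1,\dots,F_N$ be the faces of the embedding, including the unbounded one, and let $|F_i|$ be the length of the facial walk of $F_i$, so that an edge with the same face on both sides is counted twice. The Grinberg set of the embedded graph is $$\mathscr G(G)=\Big\{\Big|\sum_{i=1}^N \varepsilon_i(|F_i|-2)\Big| \;:\; \varepsilon\in\{\pm1\}^N \text{ not constant}\Big\};$$ if $G$ is a tree, so that $N=1$, every edge of $G$ is first duplicated, so that the list of face lengths becomes $2(n-1)$ followed by $n-1$ entries equal to $2$. Then $\mathscr G(G)$ has a minimum, the Grinberg number $g(G)=\min\mathscr G(G)$. For a closed walk $\sigma$ in which the vertex $v$ is visited $m_v+1$ times (the start and the end of the walk counting as one visit), the number of repeats of vertices is $\sum_v m_v$. The Hamiltonian number $h(G)$ is the minimum length of a closed walk that visits every vertex. Then: 1. every closed walk on $G$ that visits every vertex has at least $g(G)/2$ repeats of vertices; 2. $h(G)\ge n+g(G)/2$; 3. (Grinberg's theorem) if $g(G)>0$, then $G$ has no Hamiltonian cycle.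 -/

import Mathlib

/-- A combinatorial embedding (rotation system) of a graph `G` in a closed oriented surface: around
each vertex `v`, the darts (oriented edges) that start at `v` are arranged in one cyclic order, and
`next d` is the dart that follows `d` in the order around its starting vertex. -/
structure RotationSystem {V : Type*} (G : SimpleGraph V) where
  next : Equiv.Perm G.Dart
  fst_next : ∀ d : G.Dart, (next d).fst = d.fst
  sameCycle_of_fst_eq : ∀ d d' : G.Dart, d.fst = d'.fst → next.SameCycle d d'

namespace RotationSystem

variable {V : Type*} {G : SimpleGraph V}

/-- Reversal of darts, as a permutation. -/
def dartSymm (G : SimpleGraph V) : Equiv.Perm G.Dart where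
  toFun := SimpleGraph.Dart.symm
  invFun := SimpleGraph.Dart.symm
  left_inv := SimpleGraph.Dart.symm_symm
  right_inv := SimpleGraph.Dart.symm_symm

/-- Tracing the boundary of a face: having walked along the dart `d` to its end vertex, continue
along the dart that follows the reversal of `d` in the cyclic order around that vertex. -/
def facePerm (M : RotationSystem G) : Equiv.Perm G.Dart := (dartSymm G).trans M.next

/-- The faces, each represented by its facial walk: a cycle of the face tracing permutation. No face
is distinguished; the unbounded face of a drawing in the plane is one of them. -/
def Face (M : RotationSystem G) : Type _ :=
  Quotient (Equiv.Perm.SameCycle.setoid M.facePerm)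

/-- The face that lies on the traced side of a dart. -/
def faceOf (M : RotationSystem G) (d : G.Dart) : M.Face :=
  Quotient.mk (Equiv.Perm.SameCycle.setoid M.facePerm) d

/-- The length of a face: the number of edges of its facial walk. An edge which has the same face
on both sides is counted twice. -/
noncomputable def faceLength (M : RotationSystem G) (F : M.Face) : ℕ :=
  Nat.card {d : G.Dart // M.faceOf d = F}

instance finite_dart [Finite V] : Finite G.Dart := by
  classical
  have := Fintype.ofFinite V
  infer_instance

noncomputable instance [Finite V] (M : RotationSystem G) : Fintype M.Face :=
  haveI : Finite M.Face := Quotient.finite _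
  Fintype.ofFinite _

/-- The Euler characteristic `V - E + F` of the closed surface that is obtained from the graph by
gluing a disc to every facial walk. -/
noncomputable def eulerChar [Finite V] (M : RotationSystem G) : ℤ :=
  (Nat.card V : ℤ) - (Nat.card G.edgeSet : ℤ) + (Nat.card M.Face : ℤ)

/-- A rotation system of a connected graph (with at least one edge) is planar if its genus is zero,
that is, if its closed surface, which is connected and orientable, is the sphere. -/
def IsPlanar [Finite V] (M : RotationSystem G) : Prop := M.eulerChar = 2

end RotationSystem

/-- For a finite family of faces with lengths `len`: the set of all numbers `|∑ ε i * (len i - 2)|`,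
where the signs `ε i = ±1` are not all equal. -/
def signedSumSet {ι : Type*} [Fintype ι] (len : ι → ℕ) : Set ℕ :=
  {x | ∃ ε : ι → ℤˣ, (∃ i j, ε i ≠ ε j) ∧ x = (∑ i, (ε i : ℤ) * ((len i : ℤ) - 2)).natAbs}

namespace RotationSystem

variable {V : Type*} {G : SimpleGraph V}

open Classical in
/-- The Grinberg set of an embedded graph. A tree has only one face, hence no non-constant sign
vector; as usual for the Grinberg number, each of its edges is then duplicated, which leaves the
length of the face as it is and adds one face with two edges for each edge of the tree. -/
noncomputable def grinbergSet [Finite V] (M : RotationSystem G) : Set ℕ :=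
  if G.IsTree then
    letI : Fintype G.edgeSet := Fintype.ofFinite _
    signedSumSet (Sum.elim M.faceLength (fun _ : G.edgeSet => 2))
  else signedSumSet M.faceLength

/-- The Grinberg number: the minimum of the Grinberg set. -/
noncomputable def grinbergNumber [Finite V] (M : RotationSystem G) : ℕ := sInf M.grinbergSet

end RotationSystem

namespace SimpleGraph

variable {V : Type*} {G : SimpleGraph V}

/-- A walk is spanning if it visits every vertex. -/
def Walk.IsSpanning {u v : V} (w : G.Walk u v) : Prop := ∀ x : V, x ∈ w.support

/-- The number of visits of the closed walk `w` to `x`. The starting vertex, which is listed again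
as the last vertex, is counted for only one of these two occurrences. -/
def Walk.visits [DecidableEq V] {v : V} (w : G.Walk v v) (x : V) : ℕ := w.support.tail.count x

/-- The number of repeats of vertices of a closed walk: a vertex that is visited `m + 1` times is
repeated `m` times. -/
def Walk.repeats [Fintype V] [DecidableEq V] {v : V} (w : G.Walk v v) : ℕ :=
  ∑ x : V, (w.visits x - 1)

/-- The Hamiltonian number: the minimum of the lengths of the closed spanning walks. -/
noncomputable def hamiltonianNumber (G : SimpleGraph V) : ℕ :=
  sInf {l | ∃ (v : V) (w : G.Walk v v), w.IsSpanning ∧ w.length = l}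

end SimpleGraph

/-! Reduced mod 2, a closed spanning walk of length `L` is a cycle, so on the sphere it is the
boundary of a chain of faces: the faces split into classes `A` and `B`, and the set `H` of edges
between them consists of the edges traversed an odd number of times. Give `A` the sign + and `B` the
sign −. Counted by edges, the signed sum is `2((e_A - |A|) - (e_B - |B|))`, where `e_A` and `e_B`
count the edges with both sides in the class.

Let `S` be the set of edges used by the walk. The dimension count `card_add_card_le_of_separates`
bounds both `e_A - |A|` and `e_B - |B|` below by `n - 1 - |S|`, while by Euler's formula they add up
to `n - 2 - |H|`. Hence the sum is at most `2(2|S| - |H| - n)` in absolute value. Edges of `S`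
outside `H` are traversed at least twice, so this is at most `2(L - n)`, twice the number of
repeats.

If one class is empty, then `H` is empty and `L ≥ 2|S| ≥ 2(n - 1)`; an element of the Grinberg set
not exceeding `2(n - 2)` then suffices. -/

/-! ### Dimension of the mod 2 cycle space. -/

open Finset in
/-- The space of mod 2 cycles of a connected graph with `E` edges on `V` has dimension at most
`|E| - |V| + 1`; the graph is given by the ends `s e`, `t e` of its edges. -/
theorem finrank_ker_incidence_add_card_le {V E : Type*} [Fintype V] [DecidableEq V] [Fintype E]
    (s t : E → V) (hconn : ∀ f : V → ZMod 2, (∀ e, f (s e) = f (t e)) → ∀ u v, f u = f v) :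
    Module.finrank (ZMod 2) (LinearMap.ker (Matrix.mulVecLin (Matrix.of fun (v : V) (e : E) =>
      ((if s e = v then 1 else 0) + (if t e = v then 1 else 0) : ZMod 2)))) + Fintype.card V ≤
      Fintype.card E + 1 := by
  set N : Matrix V E (ZMod 2) := Matrix.of fun (v : V) (e : E) =>
      ((if s e = v then 1 else 0) + (if t e = v then 1 else 0) : ZMod 2) with hN
  have h1 := LinearMap.finrank_range_add_finrank_ker N.mulVecLin
  have h2 := LinearMap.finrank_range_add_finrank_ker N.transpose.mulVecLin
  have h3 : N.transpose.rank = N.rank := Matrix.rank_transpose N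
  rw [Matrix.rank, Matrix.rank] at h3
  rw [Module.finrank_fintype_fun_eq_card] at h1 h2
  -- The kernel of the transpose consists of the functions constant along edges, which connectedness
  -- makes globally constant.
  have h4 : Module.finrank (ZMod 2) (LinearMap.ker N.transpose.mulVecLin) ≤ 1 := by
    have hle : LinearMap.ker N.transpose.mulVecLin ≤
        Submodule.span (ZMod 2) {(fun _ => 1 : V → ZMod 2)} := by
      intro f hf
      have hc : ∀ u v, f u = f v := by
        apply hconn
        intro e
        have := congrFun (LinearMap.mem_ker.1 hf) e
        simp [hN, Matrix.vecMul, dotProduct, mul_add, sum_add_distrib] at this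
        exact CharTwo.add_eq_zero.1 this
      rw [Submodule.mem_span_singleton]
      rcases isEmpty_or_nonempty V with h | ⟨⟨v⟩⟩
      · exact ⟨0, Subsingleton.elim _ _⟩
      · exact ⟨f v, funext fun u => by simp [hc u v]⟩
    refine (Submodule.finrank_mono hle).trans ((finrank_span_le_card _).trans ?_)
    simp
  omega

/-! ### Edges, darts and closed spanning walks. -/

namespace SimpleGraph

variable {V : Type*} {G : SimpleGraph V}

theorem exists_dart_edge_eq (e : G.edgeSet) : ∃ d : G.Dart, d.edge = e.1 := by
  obtain ⟨e, he⟩ := e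
  induction e with
  | h u v => exact ⟨⟨(u, v), he⟩, rfl⟩

/-- A chosen orientation of an edge. -/
noncomputable def edgeDart (e : G.edgeSet) : G.Dart := (exists_dart_edge_eq e).choose

theorem edgeDart_edge (e : G.edgeSet) : (edgeDart e).edge = e.1 :=
  (exists_dart_edge_eq e).choose_spec

theorem edgeDart_eq_or (d : G.Dart) :
    edgeDart ⟨d.edge, d.edge_mem⟩ = d ∨ edgeDart ⟨d.edge, d.edge_mem⟩ = d.symm :=
  (dart_edge_eq_iff _ _).1 (edgeDart_edge _)

theorem sum_dart_eq_sum_edgeSet {R : Type*} [AddCommMonoid R] [Fintype G.Dart]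
    [Fintype G.edgeSet] (g : G.Dart → R) :
    ∑ d, g d = ∑ e : G.edgeSet, (g (edgeDart e) + g (edgeDart e).symm) := by
  classical
  rw [← Finset.sum_fiberwise Finset.univ (fun d : G.Dart => (⟨d.edge, d.edge_mem⟩ : G.edgeSet))]
  refine Finset.sum_congr rfl fun e _ => ?_
  have : (Finset.univ.filter fun d : G.Dart => (⟨d.edge, d.edge_mem⟩ : G.edgeSet) = e) =
      {edgeDart e, (edgeDart e).symm} := by
    ext d
    simp only [Finset.mem_filter, Finset.mem_univ, true_and, Finset.mem_insert,
      Finset.mem_singleton, Subtype.ext_iff]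
    rw [← edgeDart_edge, dart_edge_eq_iff]
  rw [this, Finset.sum_pair (Dart.symm_ne _).symm]

/-- Removes the chosen orientations from the incidence sum at `v`: what remains runs over the darts
leaving `v`, which a rotation permutes. -/
theorem sum_mul_dart_fst [Fintype G.Dart] [Fintype G.edgeSet] [DecidableEq V]
    {R : Type*} [Semiring R] (ψ : G.Dart → R) (hψ : ∀ d, ψ d.symm = ψ d) (v : V) :
    ∑ e : G.edgeSet, ((if (edgeDart e).fst = v then 1 else 0) +
      (if (edgeDart e).snd = v then 1 else 0)) * ψ (edgeDart e) =
      ∑ d : G.Dart, (if d.fst = v then 1 else 0) * ψ d := by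
  rw [sum_dart_eq_sum_edgeSet]
  refine Finset.sum_congr rfl fun e _ => ?_
  rw [hψ, add_mul]
  rfl

namespace Walk

theorem sum_edgeSet_count_edges [Fintype G.edgeSet] [DecidableEq V] {u v : V} (w : G.Walk u v) :
    ∑ e : G.edgeSet, w.edges.count e.1 = w.length := by
  rw [← length_edges, ← List.sum_toFinset_count_eq_length]
  symm
  refine Finset.sum_bij_ne_zero (fun e he _ => ⟨e, w.edges_subset_edgeSet (by simpa using he)⟩)
    ?_ ?_ ?_ ?_
  · simp
  · simp
  · intro e _ he
    refine ⟨e.1, ?_, he, rfl⟩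
    simpa [List.count_eq_zero] using he
  · simp

/-- The edges of a closed walk, counted with multiplicity mod 2, form a cycle. -/
theorem sum_count_edges_incident [Fintype G.edgeSet] [DecidableEq V] {u v : V} (w : G.Walk u v)
    (x : V) :
    ∑ e : G.edgeSet, ((if (edgeDart e).fst = x then 1 else 0) +
      (if (edgeDart e).snd = x then 1 else 0)) * (w.edges.count e.1 : ZMod 2) =
      (if u = x then 1 else 0) + (if v = x then 1 else 0) := by
  induction w with
  | nil => simp [CharTwo.add_self_eq_zero]
  | @cons a b c h p ih =>
    simp only [edges_cons, List.count_cons, Nat.cast_add, mul_add, Finset.sum_add_distrib, ih]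
    rw [Finset.sum_eq_single (⟨s(a, b), h⟩ : G.edgeSet)]
    · have h2 : ((if (edgeDart (⟨s(a, b), h⟩ : G.edgeSet)).fst = x then 1 else 0) +
          (if (edgeDart (⟨s(a, b), h⟩ : G.edgeSet)).snd = x then 1 else 0) : ZMod 2) =
          (if a = x then 1 else 0) + (if b = x then 1 else 0) := by
        rcases edgeDart_eq_or (⟨(a, b), h⟩ : G.Dart) with h' | h'
        · simp only [Dart.edge_mk] at h'
          rw [h']
        · simp only [Dart.edge_mk] at h'
          rw [h']
          exact add_comm _ _
      rw [h2]
      simp only [beq_self_eq_true, if_true, Nat.cast_one, mul_one]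
      linear_combination CharTwo.add_self_eq_zero (if b = x then 1 else 0 : ZMod 2)
    · intro e _ he
      have : ¬ s(a, b) = e.1 := fun h' => he (Subtype.ext h'.symm)
      simp [this]
    · simp

/-- For a spanning walk this expresses connectedness of its edge set, in the form used by the
dimension bounds. -/
theorem apply_eq_of_forall_dart {α : Type*} {u v : V} (w : G.Walk u v) (f : V → α)
    (hf : ∀ e : G.edgeSet, e.1 ∈ w.edges → f (edgeDart e).fst = f (edgeDart e).snd) :
    ∀ x ∈ w.support, f x = f u := by
  induction w with
  | nil => simp
  | @cons a b c h p ih =>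
    have hab : f b = f a := by
      have := hf ⟨s(a, b), h⟩ (by simp)
      rcases edgeDart_eq_or (⟨(a, b), h⟩ : G.Dart) with h' | h'
      · simp only [Dart.edge_mk] at h'
        rw [h'] at this
        exact this.symm
      · simp only [Dart.edge_mk] at h'
        rw [h'] at this
        exact this
    intro x hx
    rw [support_cons, List.mem_cons] at hx
    rcases hx with rfl | hx
    · rfl
    · rw [ih (fun e he => hf e (by simp [he])) x hx, hab]

theorem IsSpanning.mem_support_tail [Nontrivial V] {v : V} {w : G.Walk v v} (hw : w.IsSpanning)
    (x : V) : x ∈ w.support.tail := by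
  have hn : ¬ w.Nil := by
    intro h
    obtain ⟨y, hy⟩ := exists_ne v
    have := hw y
    rw [h.eq_nil] at this
    simp [hy] at this
  have := hw x
  rw [← cons_tail_support, List.mem_cons] at this
  rcases this with rfl | h
  · exact end_mem_tail_support hn
  · exact h

/-- The visits add up to the length, and each vertex has at least one, so the truncated subtraction
in `repeats` is exact. -/
theorem IsSpanning.repeats_add_card [Fintype V] [DecidableEq V] [Nontrivial V] {v : V}
    {w : G.Walk v v} (hw : w.IsSpanning) : w.repeats + Fintype.card V = w.length := by
  have h1 : ∑ x : V, w.visits x = w.length := by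
    have := Multiset.sum_count_eq_card (s := Finset.univ) (m := (w.support.tail : Multiset V))
      (by simp)
    simpa [visits] using this
  rw [repeats, ← h1, ← Finset.card_univ, Finset.card_eq_sum_ones, ← Finset.sum_add_distrib]
  refine Finset.sum_congr rfl fun x _ => Nat.sub_add_cancel ?_
  exact List.count_pos_iff.2 (hw.mem_support_tail x)

end Walk

theorem Connected.exists_closed_walk_isSpanning [Finite V] (hG : G.Connected) :
    ∃ (v : V) (w : G.Walk v v), w.IsSpanning := by
  classical
  have := Fintype.ofFinite V
  obtain ⟨v⟩ := hG.nonempty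
  have key : ∀ s : Finset V, ∃ w : G.Walk v v, ∀ x ∈ s, x ∈ w.support := by
    intro s
    induction s using Finset.induction_on with
    | empty => exact ⟨.nil, by simp⟩
    | insert a s _ ih =>
      obtain ⟨w, hw⟩ := ih
      obtain ⟨p⟩ := hG.preconnected v a
      refine ⟨w.append (p.append p.reverse), fun x hx => ?_⟩
      rw [Finset.mem_insert] at hx
      simp only [Walk.mem_support_append_iff]
      rcases hx with rfl | hx
      · exact .inr (.inl p.end_mem_support)
      · exact .inl (hw x hx)
  obtain ⟨w, hw⟩ := key Finset.univ
  exact ⟨v, w, fun x => hw x (Finset.mem_univ x)⟩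

end SimpleGraph

/-! ### Faces, their boundaries, and the cycle space. -/

open SimpleGraph in
theorem SimpleGraph.Dart.apply_symm_eq_of_edgeDart {V α : Type*} {G : SimpleGraph V}
    {g : G.Dart → α} {d : G.Dart}
    (h : g (edgeDart ⟨d.edge, d.edge_mem⟩) = g (edgeDart ⟨d.edge, d.edge_mem⟩).symm) :
    g d = g d.symm := by
  rcases edgeDart_eq_or d with h' | h'
  · rwa [h'] at h
  · rw [h', Dart.symm_symm] at h
    exact h.symm

namespace RotationSystem

open SimpleGraph Finset

variable {V : Type*} {G : SimpleGraph V} (M : RotationSystem G)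

theorem faceOf_symm (d : G.Dart) : M.faceOf d.symm = M.faceOf (M.next d) := by
  refine Quotient.sound (s := Equiv.Perm.SameCycle.setoid M.facePerm) ?_
  refine ⟨1, ?_⟩
  simp [facePerm, dartSymm]

/-- The dual graph of a connected graph is connected. -/
theorem face_apply_eq_of_forall_dart (hG : G.Connected) {α : Type*} (φ : M.Face → α)
    (h : ∀ d, φ (M.faceOf d) = φ (M.faceOf d.symm)) (F F' : M.Face) : φ F = φ F' := by
  -- Turning from `d` to `next d` around a vertex amounts to crossing the edge of `d`.
  have hnext : ∀ d, φ (M.faceOf (M.next d)) = φ (M.faceOf d) := fun d => by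
    rw [← faceOf_symm, ← h]
  have hcycle : ∀ d d' : G.Dart, d.fst = d'.fst → φ (M.faceOf d) = φ (M.faceOf d') := by
    intro d d' hd
    obtain ⟨i, rfl⟩ := M.sameCycle_of_fst_eq d d' hd
    induction i using Int.induction_on with
    | zero => rfl
    | succ i ih =>
      rw [ih ?_, add_comm, zpow_add, zpow_one, Equiv.Perm.mul_apply, hnext]
      rw [add_comm, zpow_add, zpow_one, Equiv.Perm.mul_apply, M.fst_next] at hd
      exact hd
    | pred i ih =>
      have e : (M.next ^ (-(i : ℤ))) d = M.next ((M.next ^ (-(i : ℤ) - 1)) d) := by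
        rw [← Equiv.Perm.mul_apply, ← zpow_one_add]
        congr 2
        ring
      rw [ih ?_, e, hnext]
      rw [e, M.fst_next]
      exact hd
  have hwalk : ∀ (u v : V) (_ : G.Walk u v) (d d' : G.Dart), d.fst = u → d'.fst = v →
      φ (M.faceOf d) = φ (M.faceOf d') := by
    intro u v w
    induction w with
    | nil => exact fun d d' hd hd' => hcycle d d' (hd.trans hd'.symm)
    | @cons a b c hab p ih =>
      intro d d' hd hd'
      rw [hcycle d ⟨(a, b), hab⟩ hd, h]
      exact ih _ d' rfl hd'
  induction F using Quotient.inductionOn with | _ d =>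
  induction F' using Quotient.inductionOn with | _ d' =>
  obtain ⟨w⟩ := hG.preconnected d.fst d'.fst
  exact hwalk _ _ w d d' rfl rfl

/-- The boundary mod 2 of a chain of faces. -/
noncomputable def faceBoundary : (M.Face → ZMod 2) →ₗ[ZMod 2] (G.edgeSet → ZMod 2) where
  toFun φ e := φ (M.faceOf (edgeDart e)) + φ (M.faceOf (edgeDart e).symm)
  map_add' φ ψ := by
    ext e
    simp only [Pi.add_apply]
    ring
  map_smul' c φ := by
    ext e
    simp only [Pi.smul_apply, smul_eq_mul, RingHom.id_apply]
    ring

theorem faceBoundary_apply (φ : M.Face → ZMod 2) (e : G.edgeSet) : M.faceBoundary φ e =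
    φ (M.faceOf (edgeDart e)) + φ (M.faceOf (edgeDart e).symm) := rfl

theorem faceBoundary_eq_zero (hG : G.Connected) {φ : M.Face → ZMod 2}
    (h : M.faceBoundary φ = 0) (F F' : M.Face) : φ F = φ F' := by
  refine M.face_apply_eq_of_forall_dart hG φ (fun d => ?_) F F'
  have := congrFun h ⟨d.edge, d.edge_mem⟩
  exact Dart.apply_symm_eq_of_edgeDart (g := fun d => φ (M.faceOf d)) (CharTwo.add_eq_zero.1 this)

theorem sum_mul_faceLength [Finite V] [Fintype G.Dart] {R : Type*} [CommSemiring R]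
    (g : M.Face → R) :
    ∑ F, g F * (M.faceLength F : R) = ∑ d : G.Dart, g (M.faceOf d) := by
  classical
  rw [← Finset.sum_fiberwise univ M.faceOf]
  refine sum_congr rfl fun F _ => ?_
  rw [sum_congr rfl (fun d hd => by rw [(mem_filter.1 hd).2]), sum_const, nsmul_eq_mul, mul_comm,
    faceLength, Nat.card_eq_fintype_card, Fintype.card_subtype]

/-- A dart and its successor on the facial walk are distinct, since the successor starts where the
dart ends and there are no loops. -/
theorem two_le_faceLength [Finite V] (F : M.Face) : 2 ≤ M.faceLength F := by
  classical
  induction F using Quotient.inductionOn with | _ d =>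
  have := Fintype.ofFinite G.Dart
  unfold faceLength
  rw [Nat.card_eq_fintype_card]
  refine Fintype.one_lt_card_iff.2 ⟨⟨d, rfl⟩, ⟨M.facePerm d, ?_⟩, ?_⟩
  · exact Quotient.sound (s := Equiv.Perm.SameCycle.setoid M.facePerm) ⟨-1, by simp⟩
  · intro h
    have h1 : d = M.facePerm d := congrArg Subtype.val h
    have h2 : (M.facePerm d).fst = d.symm.fst := M.fst_next d.symm
    rw [← h1] at h2
    exact d.fst_ne_snd h2

variable [Fintype V] [DecidableEq V] [DecidableRel G.Adj]

/-- Boundaries are cycles. -/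
theorem sum_faceBoundary_incident (φ : M.Face → ZMod 2) (v : V) :
    ∑ e : G.edgeSet, ((if (edgeDart e).fst = v then 1 else 0) +
      (if (edgeDart e).snd = v then 1 else 0)) * M.faceBoundary φ e = 0 := by
  simp only [faceBoundary_apply]
  rw [sum_mul_dart_fst (fun d => φ (M.faceOf d) + φ (M.faceOf d.symm))
    (fun d => by rw [Dart.symm_symm, add_comm])]
  simp only [mul_add, sum_add_distrib, faceOf_symm]
  -- Reindexing by `next`, which preserves starting vertices, makes the two sums equal, and they
  -- cancel mod 2.
  rw [← Equiv.sum_comp M.next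
    (fun d : G.Dart => (if d.fst = v then 1 else 0 : ZMod 2) * φ (M.faceOf d))]
  simp only [M.fst_next]
  exact CharTwo.add_self_eq_zero _

/-- Let `S` be a spanning connected set of edges, `A` a proper set of faces, and let `E` contain the
edges outside `S` that have a face in `A` on some side. The chains on `A` whose boundary vanishes
on `E` have their boundary in the cycle space of `S`; this bounds the number of faces in `A`. -/
theorem card_add_card_le_of_separates (hG : G.Connected) (A : Finset M.Face) (hA : A ≠ univ)
    (S : Finset G.edgeSet)
    (hS : ∀ f : V → ZMod 2, (∀ e ∈ S, f (edgeDart e).fst = f (edgeDart e).snd) →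
      ∀ u v, f u = f v)
    (E : Finset G.edgeSet)
    (hE : ∀ e ∉ S, M.faceOf (edgeDart e) ∈ A ∨ M.faceOf (edgeDart e).symm ∈ A → e ∈ E) :
    #A + Fintype.card V ≤ #E + #S + 1 := by
  classical
  have hcyc := finrank_ker_incidence_add_card_le (fun e : S => (edgeDart e.1).fst)
    (fun e : S => (edgeDart e.1).snd) (fun f hf => hS f fun e he => hf ⟨e, he⟩)
  set Z := LinearMap.ker (Matrix.mulVecLin (Matrix.of fun (v : V) (e : S) =>
      ((if (edgeDart e.1).fst = v then 1 else 0) +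
        (if (edgeDart e.1).snd = v then 1 else 0) : ZMod 2)))
  let ext : (A → ZMod 2) →ₗ[ZMod 2] (M.Face → ZMod 2) :=
    Function.ExtendByZero.linearMap _ Subtype.val
  have hext : ∀ φ (F : A), ext φ F.1 = φ F := fun φ F =>
    Subtype.val_injective.extend_apply φ 0 F
  have hext0 : ∀ φ, ∀ F ∉ A, ext φ F = 0 := fun φ F hF =>
    Function.extend_apply' φ (0 : M.Face → ZMod 2) F (fun ⟨a, ha⟩ => hF (ha ▸ a.2))
  let β := M.faceBoundary ∘ₗ ext
  let resE := LinearMap.funLeft (ZMod 2) (ZMod 2) (Subtype.val : E → G.edgeSet)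
  let resS := LinearMap.funLeft (ZMod 2) (ZMod 2) (Subtype.val : S → G.edgeSet)
  have hdim := LinearMap.finrank_range_add_finrank_ker (resE ∘ₗ β)
  have hrange := Submodule.finrank_le (LinearMap.range (resE ∘ₗ β))
  simp only [Module.finrank_fintype_fun_eq_card, Fintype.card_coe] at hdim hrange hcyc
  have hsupp : ∀ φ ∈ LinearMap.ker (resE ∘ₗ β), ∀ e ∉ S, β φ e = 0 := by
    intro φ hφ e he
    by_cases heE : e ∈ E
    · exact congrFun (LinearMap.mem_ker.1 hφ) ⟨e, heE⟩
    · have := mt (hE e he) heE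
      push Not at this
      change ext φ _ + ext φ _ = 0
      rw [hext0 φ _ this.1, hext0 φ _ this.2, add_zero]
  have hmem : ∀ φ ∈ LinearMap.ker (resE ∘ₗ β), (resS ∘ₗ β) φ ∈ Z := by
    intro φ hφ
    rw [LinearMap.mem_ker]
    ext v
    have h := M.sum_faceBoundary_incident (ext φ) v
    rw [← Finset.sum_subset (subset_univ S) (fun e _ he => by
        rw [show M.faceBoundary (ext φ) e = 0 from hsupp φ hφ e he, mul_zero]),
      ← Finset.sum_coe_sort S] at h
    exact h
  -- A chain with zero boundary is constant, and the extension by zero vanishes on a face outside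
  -- `A`.
  have hinj : Function.Injective ((resS ∘ₗ β).restrict hmem) := by
    rw [← LinearMap.ker_eq_bot, LinearMap.ker_eq_bot']
    rintro ⟨φ, hφ⟩ h0
    have h0' : (resS ∘ₗ β) φ = 0 := congrArg Subtype.val h0
    have hβ : M.faceBoundary (ext φ) = 0 := by
      ext e
      by_cases he : e ∈ S
      · exact congrFun h0' ⟨e, he⟩
      · exact hsupp φ hφ e he
    obtain ⟨F', hF'⟩ : ∃ F', F' ∉ A := by
      by_contra! h
      exact hA (eq_univ_iff_forall.2 h)
    refine Subtype.ext (funext fun F => ?_)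
    change φ F = 0
    rw [← hext φ F, M.faceBoundary_eq_zero hG hβ F.1 F', hext0 φ F' hF']
  -- The kernel has dimension at least `#A - #E` and embeds in `Z`, of dimension at most `#S + 1 -
  -- |V|`.
  have := LinearMap.finrank_le_finrank_of_injective hinj
  omega

/-- On the sphere, every cycle mod 2 is the boundary of a chain of faces. -/
theorem IsPlanar.exists_faceBoundary_eq (hM : M.IsPlanar) (hG : G.Connected)
    (x : G.edgeSet → ZMod 2)
    (hx : ∀ v, ∑ e : G.edgeSet, ((if (edgeDart e).fst = v then 1 else 0) +
      (if (edgeDart e).snd = v then 1 else 0)) * x e = 0) :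
    ∃ φ, M.faceBoundary φ = x := by
  have hcyc := finrank_ker_incidence_add_card_le (fun e : G.edgeSet => (edgeDart e).fst)
    (fun e => (edgeDart e).snd) (fun f hf u v => by
      obtain ⟨w⟩ := hG.preconnected u v
      exact (w.apply_eq_of_forall_dart f (fun e _ => hf e) v w.end_mem_support).symm)
  set Z := LinearMap.ker (Matrix.mulVecLin (Matrix.of fun (v : V) (e : G.edgeSet) =>
      ((if (edgeDart e).fst = v then 1 else 0) +
        (if (edgeDart e).snd = v then 1 else 0) : ZMod 2)))
  have hle : LinearMap.range M.faceBoundary ≤ Z := by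
    rintro _ ⟨φ, rfl⟩
    exact LinearMap.mem_ker.2 (funext fun v => M.sum_faceBoundary_incident φ v)
  have hdim := LinearMap.finrank_range_add_finrank_ker M.faceBoundary
  have hker : Module.finrank (ZMod 2) (LinearMap.ker M.faceBoundary) ≤ 1 := by
    have hle : LinearMap.ker M.faceBoundary ≤
        Submodule.span (ZMod 2) {(fun _ => 1 : M.Face → ZMod 2)} := by
      intro φ hφ
      rw [Submodule.mem_span_singleton]
      rcases isEmpty_or_nonempty M.Face with h | ⟨⟨F⟩⟩
      · exact ⟨0, Subsingleton.elim _ _⟩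
      · exact ⟨φ F, funext fun F' => by simp [M.faceBoundary_eq_zero hG hφ F F']⟩
    refine (Submodule.finrank_mono hle).trans ((finrank_span_le_card _).trans ?_)
    simp
  have hχ := hM
  simp only [IsPlanar, eulerChar, Nat.card_eq_fintype_card] at hχ
  rw [Module.finrank_fintype_fun_eq_card] at hdim
  -- The range has dimension at least `|F| - 1`, and `Z` at most `|E| - |V| + 1`, the same number by
  -- Euler's formula.
  have heq := Submodule.eq_of_le_of_finrank_le hle (by omega)
  have : x ∈ LinearMap.range M.faceBoundary := by
    rw [heq]
    exact LinearMap.mem_ker.2 (funext hx)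
  exact this

end RotationSystem

/-! ### Signed sums of face lengths. -/

/-- All terms `len i - 2` are nonnegative, so any non-constant signs work, by the triangle
inequality. -/
theorem exists_mem_signedSumSet_le {ι : Type*} [Fintype ι] (len : ι → ℕ)
    (hι : ∃ i j : ι, i ≠ j) (hlen : ∀ i, 2 ≤ len i) :
    ∃ m ∈ signedSumSet len, (m : ℤ) ≤ ∑ i, ((len i : ℤ) - 2) := by
  classical
  obtain ⟨i, j, hij⟩ := hι
  let ε : ι → ℤˣ := fun k => if k = i then 1 else -1
  refine ⟨_, ⟨ε, ⟨i, j, ?_⟩, rfl⟩, ?_⟩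
  · simp only [ε, if_true, if_neg hij.symm]
    decide
  · rw [Int.natCast_natAbs]
    refine (Finset.abs_sum_le_sum_abs _ _).trans (Finset.sum_le_sum fun k _ => ?_)
    rw [abs_mul, Int.isUnit_iff_abs_eq.1 (ε k).isUnit, one_mul, abs_of_nonneg]
    have := hlen k
    omega

namespace RotationSystem

open SimpleGraph Finset

variable {V : Type*} [Fintype V] {G : SimpleGraph V} {M : RotationSystem G}

theorem IsPlanar.isTree_iff (hM : M.IsPlanar) (hG : G.Connected) :
    G.IsTree ↔ Fintype.card M.Face = 1 := by
  have hχ := hM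
  rw [IsPlanar, eulerChar, Nat.card_eq_fintype_card (α := M.Face)] at hχ
  rw [isTree_iff_connected_and_card, and_iff_right hG]
  omega

/-- The bound is the unsigned sum `2|E| - 2|F|`, evaluated by Euler's formula; the faces of length 2
added for a tree contribute 0. -/
theorem IsPlanar.exists_mem_grinbergSet_le [Nontrivial V] (hM : M.IsPlanar) (hG : G.Connected) :
    ∃ m ∈ M.grinbergSet, (m : ℤ) ≤ 2 * (Fintype.card V - 2) := by
  classical
  have hχ := hM
  simp only [IsPlanar, eulerChar, Nat.card_eq_fintype_card] at hχ
  have hcard := hG.card_vert_le_card_edgeSet_add_one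
  simp only [Nat.card_eq_fintype_card] at hcard
  have hsum : ∑ F, ((M.faceLength F : ℤ) - 2) = 2 * (Fintype.card V - 2) := by
    have h1 := M.sum_mul_faceLength (R := ℤ) (fun _ => 1)
    rw [sum_dart_eq_sum_edgeSet] at h1
    simp only [one_mul, sum_const, card_univ, nsmul_eq_mul] at h1
    rw [sum_sub_distrib, h1, sum_const, card_univ, nsmul_eq_mul]
    linarith
  have hFpos : 0 < Fintype.card M.Face := by omega
  unfold grinbergSet
  split_ifs with hT
  · have hE : 0 < Fintype.card G.edgeSet := by
      have := Fintype.one_lt_card (α := V)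
      omega
    obtain ⟨F⟩ := Fintype.card_pos_iff.1 hFpos
    obtain ⟨e⟩ := Fintype.card_pos_iff.1 hE
    let : Fintype G.edgeSet := Fintype.ofFinite _
    obtain ⟨m, hm, hle⟩ := exists_mem_signedSumSet_le
      (Sum.elim M.faceLength (fun _ : G.edgeSet => 2)) ⟨.inl F, .inr e, by simp⟩
      (by rintro (F | e) <;> simp [M.two_le_faceLength])
    refine ⟨m, hm, hle.trans_eq ?_⟩
    rw [Fintype.sum_sum_type]
    simpa using hsum
  · rw [hM.isTree_iff hG] at hT
    obtain ⟨F, F', hF⟩ := Fintype.one_lt_card_iff.1 (show 1 < Fintype.card M.Face by omega)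
    obtain ⟨m, hm, hle⟩ := exists_mem_signedSumSet_le M.faceLength ⟨F, F', hF⟩
      M.two_le_faceLength
    exact ⟨m, hm, hle.trans_eq hsum⟩

/-- Each edge contributes the signs of its two sides: 2, −2, or 0 when it separates `A` from its
complement. -/
theorem sum_sign_mul_faceLength_sub_two [DecidableEq V] [DecidableRel G.Adj] (A : Finset M.Face)
    [DecidablePred (· ∈ A)] (ε : M.Face → ℤˣ) (hε : ∀ F, ε F = if F ∈ A then 1 else -1) :
    ∑ F, (ε F : ℤ) * ((M.faceLength F : ℤ) - 2) =
      2 * ((#{e | M.faceOf (edgeDart e) ∈ A ∧ M.faceOf (edgeDart e).symm ∈ A} : ℤ) -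
        #{e | M.faceOf (edgeDart e) ∉ A ∧ M.faceOf (edgeDart e).symm ∉ A}) -
      2 * (2 * #A - Fintype.card M.Face) := by
  have h1 := M.sum_mul_faceLength (R := ℤ) (fun F => (ε F : ℤ))
  have h2 : ∑ F, (ε F : ℤ) = 2 * #A - Fintype.card M.Face := by
    have h : ∀ F, (ε F : ℤ) = 2 * (if F ∈ A then 1 else 0) - 1 := fun F => by
      rw [hε]
      split_ifs <;> simp
    simp only [h, sum_sub_distrib, ← mul_sum, sum_boole, sum_const, nsmul_eq_mul,
      mul_one, card_univ, show ({F | F ∈ A} : Finset M.Face) = A by ext; simp]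
  simp only [mul_sub, sum_sub_distrib, ← sum_mul]
  rw [h1, h2, sum_dart_eq_sum_edgeSet, card_filter, card_filter]
  push_cast
  rw [← mul_sub, ← sum_sub_distrib, mul_sum, mul_comm _ (2 : ℤ)]
  congr 1
  · refine sum_congr rfl fun e _ => ?_
    rw [hε, hε]
    by_cases h : M.faceOf (edgeDart e) ∈ A <;> by_cases h' : M.faceOf (edgeDart e).symm ∈ A <;>
      simp [h, h']
  · ring

theorem IsPlanar.exists_mem_grinbergSet_add_card_le [DecidableEq V] [Nontrivial V] (hM : M.IsPlanar)
    (hG : G.Connected) {v : V} {w : G.Walk v v} (hw : w.IsSpanning) :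
    ∃ m ∈ M.grinbergSet, m + 2 * Fintype.card V ≤ 2 * w.length := by
  classical
  let x : G.edgeSet → ZMod 2 := fun e => w.edges.count e.1
  obtain ⟨φ, hφ⟩ := hM.exists_faceBoundary_eq M hG x
    (fun u => (w.sum_count_edges_incident u).trans (CharTwo.add_self_eq_zero _))
  have hφe : ∀ e, φ (M.faceOf (edgeDart e)) + φ (M.faceOf (edgeDart e).symm) = x e :=
    fun e => congrFun hφ e
  let S : Finset G.edgeSet := {e | e.1 ∈ w.edges}
  let H : Finset G.edgeSet := {e | x e ≠ 0}
  have hS : ∀ {α : Type} (f : V → α),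
      (∀ e ∈ S, f (edgeDart e).fst = f (edgeDart e).snd) → ∀ a b, f a = f b := by
    intro α f hf a b
    have h := w.apply_eq_of_forall_dart f (fun e he => hf e (by simpa [S] using he))
    rw [h a (hw a), h b (hw b)]
  -- An edge of the walk outside `H` has positive even multiplicity, hence at least 2.
  have hlen : 2 * #S ≤ w.length + #H := by
    rw [← w.sum_edgeSet_count_edges, card_filter, card_filter, mul_sum, ← sum_add_distrib]
    refine sum_le_sum fun e _ => ?_
    by_cases he : e.1 ∈ w.edges
    · have hpos : 0 < w.edges.count e.1 := List.count_pos_iff.2 he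
      by_cases hx : x e = 0
      · have := (ZMod.natCast_eq_zero_iff _ 2).1 hx
        have := Nat.le_of_dvd hpos this
        simp [he, hx, this]
      · simp only [he, if_true, hx, ne_eq, not_false_eq_true]
        omega
    · simp [he]
  have hcyc : Fintype.card V ≤ #S + 1 := by
    have := finrank_ker_incidence_add_card_le (fun e : S => (edgeDart e.1).fst)
      (fun e : S => (edgeDart e.1).snd) (fun f hf => hS f fun e he => hf ⟨e, he⟩)
    rw [Fintype.card_coe] at this
    omega
  -- In the constant case the walk may be a doubled spanning tree; this is also the only case when
  -- `G` is a tree.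
  by_cases hconst : ∀ F F', φ F = φ F'
  · have hH : #H = 0 := by
      rw [card_eq_zero, filter_eq_empty_iff]
      intro e _
      rw [not_not, ← hφe, hconst _ (M.faceOf (edgeDart e).symm)]
      exact CharTwo.add_self_eq_zero _
    obtain ⟨m, hm, hle⟩ := hM.exists_mem_grinbergSet_le hG
    exact ⟨m, hm, by omega⟩
  · push Not at hconst
    obtain ⟨F₁, F₂, hF⟩ := hconst
    have hT : ¬ G.IsTree := by
      rw [hM.isTree_iff hG]
      have := Fintype.one_lt_card_iff.2 ⟨F₁, F₂, fun h => hF (congrArg φ h)⟩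
      omega
    have hχ := hM
    simp only [IsPlanar, eulerChar, Nat.card_eq_fintype_card] at hχ
    have htwo : ∀ a b : ZMod 2, a ≠ b → a = 0 ∨ b = 0 := by decide
    have htwo' : ∀ a b : ZMod 2, a ≠ b → a ≠ 0 ∨ b ≠ 0 := by decide
    let A : Finset M.Face := {F | φ F = 0}
    have hmemA : ∀ F, F ∈ A ↔ φ F = 0 := fun F => by simp [A]
    let ε : M.Face → ℤˣ := fun F => if F ∈ A then 1 else -1
    let EA : Finset G.edgeSet := {e | M.faceOf (edgeDart e) ∈ A ∧ M.faceOf (edgeDart e).symm ∈ A}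
    let EB : Finset G.edgeSet := {e | M.faceOf (edgeDart e) ∉ A ∧ M.faceOf (edgeDart e).symm ∉ A}
    have hsum := sum_sign_mul_faceLength_sub_two A ε (fun _ => rfl)
    have hnotS : ∀ e ∉ S, φ (M.faceOf (edgeDart e)) = φ (M.faceOf (edgeDart e).symm) := by
      intro e he
      rw [← CharTwo.add_eq_zero, hφe]
      have : w.edges.count e.1 = 0 := List.count_eq_zero.2 (by simpa [S] using he)
      simp [x, this]
    have hA := M.card_add_card_le_of_separates hG A
      (by
        intro h
        rcases htwo' _ _ hF with h' | h'
        · exact h' ((hmemA F₁).1 (h ▸ mem_univ _))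
        · exact h' ((hmemA F₂).1 (h ▸ mem_univ _))) S hS EA
      (by
        intro e he h
        simp only [EA, mem_filter, mem_univ, true_and]
        simp only [hmemA, hnotS e he, or_self] at h ⊢
        exact ⟨h, h⟩)
    have hB := M.card_add_card_le_of_separates hG Aᶜ
      (by
        intro h
        rcases htwo _ _ hF with h' | h'
        · exact mem_compl.1 (h ▸ mem_univ F₁) ((hmemA F₁).2 h')
        · exact mem_compl.1 (h ▸ mem_univ F₂) ((hmemA F₂).2 h')) S hS EB
      (by
        intro e he h
        simp only [EB, mem_filter, mem_univ, true_and]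
        simp only [mem_compl, hmemA, hnotS e he, or_self] at h ⊢
        exact ⟨h, h⟩)
    rw [card_compl] at hB
    have hAle : #A ≤ Fintype.card M.Face := card_le_univ A
    have hE : #EA + #EB + #H = Fintype.card G.edgeSet := by
      rw [card_filter, card_filter, card_filter, ← sum_add_distrib, ← sum_add_distrib,
        ← card_univ, card_eq_sum_ones]
      refine sum_congr rfl fun e _ => ?_
      rw [← hφe]
      simp only [hmemA]
      generalize φ (M.faceOf (edgeDart e)) = a
      generalize φ (M.faceOf (edgeDart e).symm) = b
      revert a b
      decide
    refine ⟨(∑ F, (ε F : ℤ) * ((M.faceLength F : ℤ) - 2)).natAbs, ?_, ?_⟩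
    · rw [grinbergSet, if_neg hT]
      refine ⟨ε, ⟨F₁, F₂, ?_⟩, rfl⟩
      have : (F₁ ∈ A) ≠ (F₂ ∈ A) := by
        rw [hmemA, hmemA]
        generalize φ F₁ = a at hF
        generalize φ F₂ = b at hF
        revert a b
        decide
      by_cases h1 : F₁ ∈ A <;> by_cases h2 : F₂ ∈ A <;> simp_all [ε]
    -- Writing `a = #EA - #A` and `b = #EB - #Aᶜ`, use `|a - b| = a + b - 2 min(a, b)` with `hA`,
    -- `hB`, `hE`, `hχ` and `hlen`.
    · rw [hsum]
      change (2 * ((#EA : ℤ) - #EB) - _).natAbs + _ ≤ _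
      omega

end RotationSystem

/-! ### The Grinberg bounds. -/

theorem mainTheorem1 {V : Type*} [Fintype V] [DecidableEq V] [Nontrivial V]
    (G : SimpleGraph V) (hG : G.Connected) (M : RotationSystem G) (hM : M.IsPlanar) :
    IsLeast M.grinbergSet M.grinbergNumber ∧
    (∀ (v : V) (w : G.Walk v v), w.IsSpanning → (M.grinbergNumber : ℚ) / 2 ≤ (w.repeats : ℚ)) ∧
    (Fintype.card V : ℚ) + (M.grinbergNumber : ℚ) / 2 ≤ (G.hamiltonianNumber : ℚ) ∧
    (0 < M.grinbergNumber → ¬ G.IsHamiltonian) := by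
  have hmain : ∀ (v : V) (w : G.Walk v v), w.IsSpanning →
      M.grinbergNumber + 2 * Fintype.card V ≤ 2 * w.length := by
    intro v w hw
    obtain ⟨m, hm, hle⟩ := hM.exists_mem_grinbergSet_add_card_le hG hw
    have : M.grinbergNumber ≤ m := Nat.sInf_le hm
    omega
  obtain ⟨v₀, w₀, hw₀⟩ := hG.exists_closed_walk_isSpanning
  refine ⟨⟨Nat.sInf_mem ?_, fun m hm => Nat.sInf_le hm⟩, fun v w hw => ?_, ?_, fun hpos hH => ?_⟩
  -- Nonemptiness is needed because `sInf ∅ = 0` on the naturals.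
  · obtain ⟨m, hm, -⟩ := hM.exists_mem_grinbergSet_le hG
    exact ⟨m, hm⟩
  · have h1 := hmain v w hw
    rw [← hw.repeats_add_card] at h1
    have h2 : M.grinbergNumber ≤ w.repeats * 2 := by omega
    rw [div_le_iff₀ two_pos]
    exact_mod_cast h2
  · obtain ⟨v, w, hw, hl⟩ : G.hamiltonianNumber ∈
        {l | ∃ (v : V) (w : G.Walk v v), w.IsSpanning ∧ w.length = l} :=
      Nat.sInf_mem ⟨_, v₀, w₀, hw₀, rfl⟩
    have h : ((M.grinbergNumber + 2 * Fintype.card V : ℕ) : ℚ) ≤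
        (2 * G.hamiltonianNumber : ℕ) := by
      rw [← hl]
      exact_mod_cast hmain v w hw
    push_cast at h
    linarith
  -- `IsHamiltonian` yields a cycle only when there is not exactly one vertex; its length `n` leaves
  -- no room for a positive Grinberg number.
  · obtain ⟨v, w, hw⟩ := hH Fintype.one_lt_card.ne'
    have h := hmain v w hw.mem_support
    rw [hw.length_eq] at h
    omega
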